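/- Let $d$ be a positive integer. Let $A_d=\mathbb Z[\tfrac1d][q^{\pm 1/d}]$, and let $\Lambda_d\subset\mathbb Q(q^{1/d})$ be the ring obtained from $A_d$ by adjoining the inverses of the cyclotomic polynomials $\Phi_s(q^{1/d})$ for all positive integers $s$ that are not coprime with $d$. Put $(q;q)_n=\prod_{i=1}^{n}(1-q^i)$ and $$\hat\Lambda_d=\varprojlim_n \Lambda_d/((q;q)_n).$$ Let $U_d$ be the set of all complex roots of unity whose order is odd and coprime with $d$. For $\xi\in U_d$ of order $r$ there is an integer $b$, unique modulo $r$, with $(\xi^b)^d=\xi$; let $\mathrm{ev}_\xi:\Lambda_d\to\mathbb C$ be the ring homomorphism given by the substitution $q^{1/d}=\xi^b$. Since $\mathrm{ev}_\xi((q;q)_n)=0$ for $n\ge r$, it induces a ring homomorphism $\mathrm{ev}_\xi:\hat\Lambda_d\to\mathbb C$. For $\Omega\subset U_d$ let $$\mathrm{ev}_\Omega:\hat\Lambda_d\to\prod_{\xi\in\Omega}\mathbb C,\qquad \mathrm{ev}_\Omega(f)=(\mathrm{ev}_\xi(f))_{\xi\in\Omega}.$$ **Theorem.** Suppose $\Omega\subset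 U_d$ contains infinitely many roots of unity of prime-power order. If $f,g\in\hat\Lambda_d$ satisfy $\mathrm{ev}_\xi(f)=\mathrm{ev}_\xi(g)$ for every $\xi\in\Omega$, then $f=g$. In other words, the map $\mathrm{ev}_\Omega$ is injective. -/

import Mathlib

namespace CycloCompletion

open Polynomial

noncomputable section

/-- The variable `t = q^{1/d}`; the ambient field `ℚ(q^{1/d})` is `RatFunc ℚ`, the field of
rational functions in `t`. -/
def qRoot : RatFunc ℚ := RatFunc.X

/-- The ring `A_d = ℤ[1/d][q^{±1/d}]`, inside `ℚ(q^{1/d})`. -/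
def A (d : ℕ) : Subring (RatFunc ℚ) :=
  Subring.closure {(d : RatFunc ℚ)⁻¹, qRoot, qRoot⁻¹}

/-- The inverses of the cyclotomic polynomials `Φ_s(q^{1/d})`, where `s` is a positive integer
that is not coprime with `d`. -/
def cyclotomicInverses (d : ℕ) : Set (RatFunc ℚ) :=
  {x | ∃ s : ℕ, 0 < s ∧ ¬ Nat.Coprime s d ∧
    x = (algebraMap ℚ[X] (RatFunc ℚ) (cyclotomic s ℚ))⁻¹}

/-- The ring `Λ_d`: the subring of `ℚ(q^{1/d})` obtained from `A_d` by adding the inverses of all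
`Φ_s(q^{1/d})` with `s` not coprime with `d`. -/
def Lam (d : ℕ) : Subring (RatFunc ℚ) :=
  Subring.closure ((A d : Set (RatFunc ℚ)) ∪ cyclotomicInverses d)

theorem qRoot_mem_Lam (d : ℕ) : qRoot ∈ Lam d :=
  Subring.subset_closure (Or.inl (Subring.subset_closure (by simp)))

/-- The element `q = (q^{1/d})^d` of `Λ_d`. -/
def q (d : ℕ) : Lam d := ⟨qRoot, qRoot_mem_Lam d⟩ ^ d

/-- The `q`-Pochhammer symbol `(a;q)_n = ∏_{i=0}^{n-1} (1 - a q^i)` in a commutative ring. -/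
def qPochhammer {R : Type*} [CommRing R] (a q : R) (n : ℕ) : R :=
  ∏ i ∈ Finset.range n, (1 - a * q ^ i)

/-- The ideal of `Λ_d` generated by `(q;q)_n`. -/
def qIdeal (d n : ℕ) : Ideal (Lam d) := Ideal.span {qPochhammer (q d) (q d) n}

theorem qIdeal_anti (d : ℕ) {m n : ℕ} (h : m ≤ n) : qIdeal d n ≤ qIdeal d m := by
  unfold qIdeal
  rw [Ideal.span_singleton_le_span_singleton]
  exact Finset.prod_dvd_prod_of_subset _ _ _ (Finset.range_mono h)

/-- The completion `lim_n Λ_d / ((q;q)_n)`: the ring of compatible sequences. -/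
def LamHat (d : ℕ) : Subring ((n : ℕ) → Lam d ⧸ qIdeal d n) where
  carrier := {x | ∀ (m n : ℕ) (h : m ≤ n),
    Ideal.Quotient.factor (qIdeal_anti d h) (x n) = x m}
  zero_mem' := fun m n h => map_zero _
  one_mem' := fun m n h => map_one _
  add_mem' := fun {x y} hx hy m n h => by
    simp only [Pi.add_apply, map_add, hx m n h, hy m n h]
  mul_mem' := fun {x y} hx hy m n h => by
    simp only [Pi.mul_apply, map_mul, hx m n h, hy m n h]
  neg_mem' := fun {x} hx m n h => by
    simp only [Pi.neg_apply, map_neg, hx m n h]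

/-- The set `U_d` of complex roots of unity whose order is odd and coprime with `d`. -/
def U (d : ℕ) : Set ℂ :=
  {ξ | Odd (orderOf ξ) ∧ Nat.Coprime (orderOf ξ) d}

theorem exists_root (d : ℕ) {ξ : ℂ} (hξ : ξ ∈ U d) : ∃ b : ℤ, (ξ ^ b) ^ d = ξ := by
  have h0 : ξ ≠ 0 := by
    rintro rfl
    have := hξ.1
    simp at this
  refine ⟨Nat.gcdB (orderOf ξ) d, ?_⟩
  have h := Nat.gcd_eq_gcd_ab (orderOf ξ) d
  rw [Nat.Coprime.gcd_eq_one hξ.2] at h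
  rw [← zpow_natCast, ← zpow_mul]
  have h1 : ξ ^ ((1 : ℕ) : ℤ) = ξ := by simp
  rw [h, zpow_add₀ h0, zpow_mul, zpow_natCast, pow_orderOf_eq_one, one_zpow, one_mul,
    mul_comm] at h1
  exact h1

/-- The value of `q^{1/d}` under the evaluation `q = ξ`: the number `ξ^b`, where `b` is an
integer, unique modulo the order of `ξ`, such that `(ξ^b)^d = ξ`. -/
def rootValue (d : ℕ) {ξ : ℂ} (hξ : ξ ∈ U d) : ℂ := ξ ^ (exists_root d hξ).choose

theorem rootValue_pow (d : ℕ) {ξ : ℂ} (hξ : ξ ∈ U d) : rootValue d hξ ^ d = ξ :=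
  (exists_root d hξ).choose_spec

theorem rootValue_pow_orderOf (d : ℕ) {ξ : ℂ} (hξ : ξ ∈ U d) :
    rootValue d hξ ^ orderOf ξ = 1 := by
  unfold rootValue
  rw [← zpow_natCast, zpow_comm, zpow_natCast, pow_orderOf_eq_one, one_zpow]

theorem cyclotomic_rootValue_ne_zero (d : ℕ) {ξ : ℂ} (hξ : ξ ∈ U d) {s : ℕ} (hs : 0 < s)
    (hsd : ¬ Nat.Coprime s d) :
    (cyclotomic s ℚ).eval₂ (algebraMap ℚ ℂ) (rootValue d hξ) ≠ 0 := by
  intro h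
  have : NeZero s := ⟨hs.ne'⟩
  have : NeZero (s : ℂ) := ⟨by exact_mod_cast hs.ne'⟩
  rw [← eval_map, map_cyclotomic] at h
  have hp : IsPrimitiveRoot (rootValue d hξ) s := isRoot_cyclotomic_iff.1 h
  exact hsd (hξ.2.coprime_dvd_left (hp.dvd_of_pow_eq_one _ (rootValue_pow_orderOf d hξ)))

/-- Elements of `Λ_d` have no pole at `q^{1/d} = ξ^b`. -/
theorem denom_ne_zero (d : ℕ) {ξ : ℂ} (hξ : ξ ∈ U d) {f : RatFunc ℚ} (hf : f ∈ Lam d) :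
    f.denom.eval₂ (algebraMap ℚ ℂ) (rootValue d hξ) ≠ 0 := by
  set φ := algebraMap ℚ ℂ
  set z := rootValue d hξ with hz
  have hdvd : ∀ {a b : ℚ[X]}, a ∣ b → b.eval₂ φ z ≠ 0 → a.eval₂ φ z ≠ 0 := by
    rintro a b ⟨c, rfl⟩ hb ha
    exact hb (by rw [eval₂_mul, ha, zero_mul])
  have hinv : ∀ p : ℚ[X], p.eval₂ φ z ≠ 0 →
      ((algebraMap ℚ[X] (RatFunc ℚ) p)⁻¹).denom.eval₂ φ z ≠ 0 := by
    intro p hp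
    refine hdvd ?_ hp
    have hp0 : p ≠ 0 := by
      rintro rfl
      simp at hp
    have := RatFunc.denom_div_dvd (1 : ℚ[X]) p
    simpa using this
  have hadd : ∀ x y : RatFunc ℚ, x.denom.eval₂ φ z ≠ 0 → y.denom.eval₂ φ z ≠ 0 →
      (x + y).denom.eval₂ φ z ≠ 0 := fun x y hx hy =>
    hdvd (RatFunc.denom_add_dvd x y) (by rw [eval₂_mul]; exact mul_ne_zero hx hy)
  have hmul : ∀ x y : RatFunc ℚ, x.denom.eval₂ φ z ≠ 0 → y.denom.eval₂ φ z ≠ 0 →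
      (x * y).denom.eval₂ φ z ≠ 0 := fun x y hx hy =>
    hdvd (RatFunc.denom_mul_dvd x y) (by rw [eval₂_mul]; exact mul_ne_zero hx hy)
  have hneg : ∀ x : RatFunc ℚ, x.denom.eval₂ φ z ≠ 0 → (-x).denom.eval₂ φ z ≠ 0 := by
    intro x hx
    have h1 : (-1 : RatFunc ℚ) = RatFunc.C (-1) := by simp
    rw [← neg_one_mul, h1]
    exact hmul _ _ (by rw [RatFunc.denom_C]; simp) hx
  have hz0 : z ≠ 0 := by
    intro h0
    have h1 := rootValue_pow_orderOf d hξ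
    rw [← hz, h0, zero_pow hξ.1.pos.ne'] at h1
    exact zero_ne_one h1
  refine Subring.closure_induction ?_ (by simp) (by simp) (fun x y _ _ => hadd x y)
    (fun x _ => hneg x) (fun x y _ _ => hmul x y) hf
  rintro x (hx | ⟨s, hs, hsd, rfl⟩)
  · refine Subring.closure_induction ?_ (by simp) (by simp) (fun x y _ _ => hadd x y)
      (fun x _ => hneg x) (fun x y _ _ => hmul x y) hx
    rintro x (rfl | rfl | rfl)
    · have h1 : (d : RatFunc ℚ)⁻¹ = RatFunc.C ((d : ℚ)⁻¹) := by simp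
      rw [h1, RatFunc.denom_C]
      simp
    · simp [qRoot, RatFunc.denom_X]
    · rw [qRoot, ← RatFunc.algebraMap_X]
      exact hinv _ (by simpa using hz0)
  · exact hinv _ (cyclotomic_rootValue_ne_zero d hξ hs hsd)

/-- The evaluation `ev_ξ : Λ_d → ℂ`, for `ξ ∈ U_d`: the substitution `q^{1/d} = ξ^b`. -/
def evLam (d : ℕ) {ξ : ℂ} (hξ : ξ ∈ U d) : Lam d →+* ℂ where
  toFun f := RatFunc.eval (algebraMap ℚ ℂ) (rootValue d hξ) (f : RatFunc ℚ)
  map_zero' := by simp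
  map_one' := by simp
  map_add' f g := RatFunc.eval_add _ _ (denom_ne_zero d hξ f.2) (denom_ne_zero d hξ g.2)
  map_mul' f g := RatFunc.eval_mul _ _ (denom_ne_zero d hξ f.2) (denom_ne_zero d hξ g.2)

theorem evLam_q (d : ℕ) {ξ : ℂ} (hξ : ξ ∈ U d) : evLam d hξ (q d) = ξ := by
  rw [q, map_pow]
  have : evLam d hξ ⟨qRoot, qRoot_mem_Lam d⟩ = rootValue d hξ := by
    simp [evLam, qRoot]
  rw [this, rootValue_pow]

/-- `ev_ξ` kills `(q;q)_n` as soon as `n` is at least the order of `ξ`. -/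
theorem evLam_qIdeal (d : ℕ) {ξ : ℂ} (hξ : ξ ∈ U d) {n : ℕ} (hn : orderOf ξ ≤ n)
    (f : Lam d) (hf : f ∈ qIdeal d n) : evLam d hξ f = 0 := by
  obtain ⟨g, rfl⟩ := Ideal.mem_span_singleton'.1 hf
  have hpos : 0 < orderOf ξ := hξ.1.pos
  rw [map_mul, qPochhammer, map_prod]
  refine mul_eq_zero_of_right _ (Finset.prod_eq_zero (i := orderOf ξ - 1)
    (Finset.mem_range.2 (by omega)) ?_)
  rw [← pow_succ', Nat.sub_add_cancel hpos, map_sub, map_one, map_pow, evLam_q,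
    pow_orderOf_eq_one, sub_self]

/-- The evaluation `ev_ξ` on the completion: an element `x` is sent to `ev_ξ` of its
component `x_r ∈ Λ_d / ((q;q)_r)`, where `r` is the order of `ξ`. -/
def ev (d : ℕ) {ξ : ℂ} (hξ : ξ ∈ U d) : LamHat d →+* ℂ :=
  ((Ideal.Quotient.lift (qIdeal d (orderOf ξ)) (evLam d hξ)
    (evLam_qIdeal d hξ le_rfl)).comp (Pi.evalRingHom _ (orderOf ξ))).comp (LamHat d).subtype

/-- Any component `x_n` with `n` at least the order of `ξ` gives the same value. -/
theorem ev_eq (d : ℕ) {ξ : ℂ} (hξ : ξ ∈ U d) {n : ℕ} (hn : orderOf ξ ≤ n) (x : LamHat d) :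
    ev d hξ x = Ideal.Quotient.lift (qIdeal d n) (evLam d hξ) (evLam_qIdeal d hξ hn)
      ((x : (n : ℕ) → Lam d ⧸ qIdeal d n) n) := by
  have h := x.2 (orderOf ξ) n hn
  simp only [ev, RingHom.comp_apply, Subring.subtype_apply, Pi.evalRingHom_apply]
  rw [← h]
  obtain ⟨a, ha⟩ := Ideal.Quotient.mk_surjective ((x : (n : ℕ) → Lam d ⧸ qIdeal d n) n)
  rw [← ha]
  simp

/-- The map `ev_Ω` from the completion to `∏_{ξ ∈ Ω} ℂ`, for `Ω ⊆ U_d`. -/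
def evOn (d : ℕ) {Ω : Set ℂ} (hΩ : Ω ⊆ U d) : LamHat d →+* (Ω → ℂ) :=
  RingHom.pi fun ξ => ev d (hΩ ξ.2)

end

end CycloCompletion

namespace CycloCompletion

open Polynomial

/-! Put X = q^{1/d}. Modulo (q;q)_n the elements inverted in `Λ_d` are already units of ℤ[1/d][X],
so an element of the completion is a sequence of polynomials F_n, compatible modulo the factors Φ_s
of (q;q)_n with s coprime with d (`associated_qPochhammer`, `exists_denominator`). It remains to
show that these factors divide F_n.

If r is a power of p and φ(r) ≥ N, then Φ_r lies in (p, (X-1)^N). Vanishing at many such roots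
therefore makes F_n divisible, modulo (X-1)^N, by large products of primes not dividing d. Since
ℤ[1/d][X]/((X-1)^N) is separated for such integers, the expansion at 1 vanishes
(`cyclotomic_one_pow_dvd`). As Φ_s^p lies in (p, Φ_{ps}), the vanishing passes from Φ_s to Φ_{ps}
(`cyclotomic_prime_mul_pow_dvd`), hence to every s coprime with d. -/

/-! ### Separatedness over ℤ[1/d]. -/

/-- The ring `ℤ[1/d]`, inside `ℚ`. -/
def ZInv (d : ℕ) : Subring ℚ := Subring.closure {(d : ℚ)⁻¹}

theorem ZInv.map_injective (d : ℕ) :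
    Function.Injective (Polynomial.map (ZInv d).subtype) :=
  Polynomial.map_injective _ Subtype.val_injective

theorem ZInv.isUnit_natCast {d : ℕ} (hd : 0 < d) : IsUnit (d : ZInv d) := by
  refine IsUnit.of_mul_eq_one ⟨(d : ℚ)⁻¹, Subring.subset_closure rfl⟩ ?_
  apply Subtype.ext
  have : (d : ℚ) ≠ 0 := by exact_mod_cast hd.ne'
  simp [this]

theorem ZInv.exists_pow_mul_eq_intCast {d : ℕ} (hd : 0 < d) (x : ZInv d) :
    ∃ (j : ℕ) (a : ℤ), (d : ℚ) ^ j * x = a := by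
  obtain ⟨x, hx⟩ := x
  have hd0 : (d : ℚ) ≠ 0 := by exact_mod_cast hd.ne'
  change ∃ (j : ℕ) (a : ℤ), (d : ℚ) ^ j * x = a
  induction hx using Subring.closure_induction with
  | mem x hx =>
    rw [Set.mem_singleton_iff] at hx
    subst hx
    exact ⟨1, 1, by simp [hd0]⟩
  | zero => exact ⟨0, 0, by simp⟩
  | one => exact ⟨0, 1, by simp⟩
  | add x y _ _ hx hy =>
    obtain ⟨i, a, ha⟩ := hx
    obtain ⟨j, b, hb⟩ := hy
    refine ⟨i + j, d ^ j * a + d ^ i * b, ?_⟩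
    push_cast
    rw [← ha, ← hb]
    ring
  | neg x _ hx =>
    obtain ⟨i, a, ha⟩ := hx
    exact ⟨i, -a, by push_cast; rw [← ha]; ring⟩
  | mul x y _ _ hx hy =>
    obtain ⟨i, a, ha⟩ := hx
    obtain ⟨j, b, hb⟩ := hy
    refine ⟨i + j, a * b, ?_⟩
    push_cast
    rw [← ha, ← hb]
    ring

/-- An element of `ℤ[1/d]` with arbitrarily large divisors coprime with `d` vanishes. -/
theorem ZInv.eq_zero_of_dvd {d : ℕ} (hd : 0 < d) (x : ZInv d)
    (h : ∀ C : ℕ, ∃ N ≥ C, N.Coprime d ∧ (N : ZInv d) ∣ x) : x = 0 := by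
  obtain ⟨j, a, ha⟩ := ZInv.exists_pow_mul_eq_intCast hd x
  have hd0 : (d : ℚ) ≠ 0 := by exact_mod_cast hd.ne'
  -- Once denominators are cleared, N still divides the integer a, being coprime with d; N > |a|
  -- then forces a = 0.
  obtain ⟨N, hN, hNd, y, rfl⟩ := h (a.natAbs + 1)
  obtain ⟨i, b, hb⟩ := ZInv.exists_pow_mul_eq_intCast hd y
  have h1 : (d : ℤ) ^ i * a = N * (d ^ j * b) := by
    have : (d : ℚ) ^ i * a = N * (d ^ j * b) := by
      rw [← ha, ← hb]
      push_cast
      ring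
    exact_mod_cast this
  have h2 : (N : ℤ) ∣ a := by
    have h4 : IsCoprime (N : ℤ) ((d : ℤ) ^ i) := (Nat.isCoprime_iff_coprime.2 hNd).pow_right
    exact h4.dvd_of_dvd_mul_left ⟨_, h1⟩
  have h3 : a = 0 := Int.eq_zero_of_abs_lt_dvd h2 (by rw [Int.abs_eq_natAbs]; omega)
  apply Subtype.ext
  rw [h3, Int.cast_zero] at ha
  simpa [hd0] using ha

/-- `ℤ[1/d][X]/(Q)`, for `Q` monic, is separated for the topology given by the integers coprime
with `d`. -/
theorem dvd_of_mem_span_natCast_sup {d : ℕ} (hd : 0 < d) {Q F : (ZInv d)[X]} (hQ : Q.Monic)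
    (h : ∀ C : ℕ, ∃ N ≥ C, N.Coprime d ∧
      F ∈ Ideal.span {(N : (ZInv d)[X])} ⊔ Ideal.span {Q}) : Q ∣ F := by
  -- The remainder modulo Q is linear, so each of its coefficients is divisible by every such N.
  rw [← modByMonic_eq_zero_iff_dvd hQ]
  ext1 i
  rw [coeff_zero]
  refine ZInv.eq_zero_of_dvd hd _ fun C => ?_
  obtain ⟨N, hN, hNd, hF⟩ := h C
  refine ⟨N, hN, hNd, ?_⟩
  obtain ⟨G, H, hH, rfl⟩ := Ideal.mem_span_singleton_sup.1 hF
  rw [add_modByMonic, (modByMonic_eq_zero_iff_dvd hQ).2 (Ideal.mem_span_singleton.1 hH), add_zero,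
    mul_comm, ← C_eq_natCast, ← smul_eq_C_mul, smul_modByMonic, coeff_smul]
  exact ⟨_, rfl⟩

/-! ### Congruences between cyclotomic polynomials modulo p. -/

theorem mem_span_natCast_sup_of_dvd_zmod {R : Type*} [CommRing R] (p : ℕ) {f g : ℤ[X]}
    (h : g.map (Int.castRingHom (ZMod p)) ∣ f.map (Int.castRingHom (ZMod p))) :
    f.map (Int.castRingHom R) ∈
      Ideal.span {(p : R[X])} ⊔ Ideal.span {g.map (Int.castRingHom R)} := by
  obtain ⟨c, hc⟩ := h
  obtain ⟨c, rfl⟩ := Polynomial.map_surjective (Int.castRingHom (ZMod p))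
    (ZMod.ringHom_surjective _) c
  have h1 : C (p : ℤ) ∣ f - g * c := by
    rw [C_dvd_iff_dvd_coeff]
    intro i
    rw [← ZMod.intCast_zmod_eq_zero_iff_dvd]
    have := congrArg (fun q => coeff q i) hc
    rw [← Polynomial.map_mul] at this
    simp only [coeff_map, eq_intCast] at this
    rw [coeff_sub, Int.cast_sub, this, sub_self]
  obtain ⟨e, he⟩ := h1
  refine Ideal.mem_span_singleton_sup.2 ⟨e.map (Int.castRingHom R),
    g.map (Int.castRingHom R) * c.map (Int.castRingHom R),
    Ideal.mem_span_singleton.2 (dvd_mul_right _ _), ?_⟩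
  rw [eq_add_of_sub_eq he]
  simp [mul_comm]

theorem prod_mem_span_prod_sup {R ι : Type*} [CommRing R] (T : Finset ι) (c g : ι → R)
    (J : Ideal R) (h : ∀ i ∈ T, g i ∈ Ideal.span {c i} ⊔ J) :
    ∏ i ∈ T, g i ∈ Ideal.span {∏ i ∈ T, c i} ⊔ J := by
  classical
  induction T using Finset.induction_on with
  | empty => simp
  | insert a T ha ih =>
    obtain ⟨x, j, hj, h1⟩ := Ideal.mem_span_singleton_sup.1 (h a (Finset.mem_insert_self a T))
    obtain ⟨y, k, hk, h2⟩ := Ideal.mem_span_singleton_sup.1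
      (ih fun i hi => h i (Finset.mem_insert_of_mem hi))
    refine Ideal.mem_span_singleton_sup.2 ⟨x * y, x * c a * k + j * ∏ i ∈ T, g i,
      J.add_mem (J.mul_mem_left _ hk) (J.mul_mem_right _ hj), ?_⟩
    rw [Finset.prod_insert ha, Finset.prod_insert ha, ← h1, ← h2]
    ring

/-- For a prime power `r = p^k`, `Φ_r` lies in `(p, (X-1)^N)` as soon as `N ≤ φ(r)`. -/
theorem cyclotomic_prime_pow_mem {R : Type*} [CommRing R] {p k N : ℕ} (hp : p.Prime) (hk : 0 < k)
    (hN : N ≤ (p ^ k).totient) :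
    cyclotomic (p ^ k) R ∈ Ideal.span {(p : R[X])} ⊔ Ideal.span {(cyclotomic 1 R) ^ N} := by
  have : Fact p.Prime := ⟨hp⟩
  have h := mem_span_natCast_sup_of_dvd_zmod (R := R) p (f := cyclotomic (p ^ k) ℤ)
    (g := cyclotomic 1 ℤ ^ N) ?_
  · simpa only [Polynomial.map_pow, map_cyclotomic] using h
  -- In characteristic p, Φ_{p^k} = Φ_1^{p^k - p^{k-1}}, with exponent φ(p^k).
  · rw [Polynomial.map_pow, map_cyclotomic, map_cyclotomic, ← mul_one (p ^ k),
      cyclotomic_mul_prime_pow_eq (ZMod p) hp.not_dvd_one hk]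
    apply pow_dvd_pow
    rw [Nat.totient_prime_pow hp hk, mul_comm] at hN
    obtain ⟨k, rfl⟩ := Nat.exists_eq_add_of_lt hk
    simp only [zero_add, Nat.add_sub_cancel] at hN ⊢
    rwa [pow_succ', ← Nat.sub_one_mul]

/-- In characteristic p, Φ_{ps} equals Φ_s^p or Φ_s^{p-1}, according to whether p divides s. -/
theorem cyclotomic_pow_prime_mem {R : Type*} [CommRing R] {p : ℕ} (s : ℕ) (hp : p.Prime) :
    cyclotomic s R ^ p ∈ Ideal.span {(p : R[X])} ⊔ Ideal.span {cyclotomic (p * s) R} := by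
  have : Fact p.Prime := ⟨hp⟩
  have h := mem_span_natCast_sup_of_dvd_zmod (R := R) p (f := cyclotomic s ℤ ^ p)
    (g := cyclotomic (p * s) ℤ) ?_
  · simpa only [Polynomial.map_pow, map_cyclotomic] using h
  · rw [Polynomial.map_pow, map_cyclotomic, map_cyclotomic, mul_comm p s]
    by_cases hps : p ∣ s
    · rw [cyclotomic_mul_prime_dvd_eq_pow _ hps]
    · rw [cyclotomic_mul_prime_eq_pow_of_not_dvd _ hps]
      exact pow_dvd_pow _ (Nat.sub_le _ _)

/-! ### Multiplicities of the cyclotomic factors of (q;q)_n. -/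

/-- The part of `(q;q)_n` made of the `Φ_s(q^{1/d})` with `s` coprime with `d`. -/
noncomputable def cycloProd (d n : ℕ) (R : Type*) [CommRing R] : R[X] :=
  ∏ i ∈ Finset.range n, ∏ s ∈ (d * (i + 1)).divisors with s.Coprime d, cyclotomic s R

/-- Φ_s occurs once in each of the b factors with i + 1 = s(j + 1), j < b. -/
theorem cyclotomic_pow_dvd_cycloProd {d : ℕ} (hd : 0 < d) {s : ℕ} (hs : 0 < s)
    (hsd : s.Coprime d) (R : Type*) [CommRing R] (b : ℕ) {n : ℕ} (hn : s * b ≤ n) :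
    cyclotomic s R ^ b ∣ cycloProd d n R := by
  have hpos : ∀ j, 0 < s * (j + 1) := fun j => Nat.mul_pos hs j.succ_pos
  have hinj : Function.Injective fun j => s * (j + 1) - 1 := by
    intro i j hij
    have h1 : s * (i + 1) - 1 = s * (j + 1) - 1 := hij
    have h2 : s * (i + 1) = s * (j + 1) := by
      have := hpos i
      have := hpos j
      omega
    exact Nat.succ_injective (Nat.eq_of_mul_eq_mul_left hs h2)
  have h1 : cyclotomic s R ^ b = ∏ i ∈ (Finset.range b).image (fun j => s * (j + 1) - 1),
      cyclotomic s R := by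
    rw [Finset.prod_const, Finset.card_image_of_injective _ hinj, Finset.card_range]
  rw [h1, cycloProd]
  refine (Finset.prod_dvd_prod_of_dvd _ _ fun i hi => ?_).trans
    (Finset.prod_dvd_prod_of_subset _ _ _ fun i hi => ?_)
  · obtain ⟨j, -, rfl⟩ := Finset.mem_image.1 hi
    refine Finset.dvd_prod_of_mem (fun s => cyclotomic s R)
      (Finset.mem_filter.2 ⟨Nat.mem_divisors.2 ?_, hsd⟩)
    rw [Nat.sub_add_cancel (hpos j)]
    exact ⟨(dvd_mul_right s _).mul_left d, (Nat.mul_pos hd (hpos j)).ne'⟩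
  · obtain ⟨j, hj, rfl⟩ := Finset.mem_image.1 hi
    rw [Finset.mem_range] at hj ⊢
    have h2 : s * (j + 1) ≤ s * b := Nat.mul_le_mul_left _ hj
    have := hpos j
    omega

theorem cycloProd_dvd_prod_pow (d n : ℕ) (R : Type*) [CommRing R] :
    cycloProd d n R ∣ ∏ s ∈ (Finset.Icc 1 (d * n)) with s.Coprime d, cyclotomic s R ^ n := by
  rw [Finset.prod_pow]
  nth_rw 3 [← Finset.card_range n]
  rw [← Finset.prod_const]
  refine Finset.prod_dvd_prod_of_dvd _ _ fun i hi => Finset.prod_dvd_prod_of_subset _ _ _ ?_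
  refine Finset.filter_subset_filter _ fun s hs => ?_
  rw [Finset.mem_range] at hi
  rw [Nat.mem_divisors] at hs
  have h1 := Nat.le_of_dvd (Nat.pos_of_ne_zero hs.2) hs.1
  have h2 : d * (i + 1) ≤ d * n := Nat.mul_le_mul_left _ hi
  exact Finset.mem_Icc.2 ⟨Nat.pos_of_dvd_of_pos hs.1 (Nat.pos_of_ne_zero hs.2), h1.trans h2⟩

/-- Distinct Φ_s need not be comaximal over ℤ[1/d], but they are over ℚ, and divisibility by a monic
polynomial descends from ℚ. -/
theorem prod_cyclotomic_pow_dvd {d : ℕ} {F : (ZInv d)[X]} (T : Finset ℕ) (b : ℕ)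
    (h : ∀ s ∈ T, cyclotomic s (ZInv d) ^ b ∣ F) : ∏ s ∈ T, cyclotomic s (ZInv d) ^ b ∣ F := by
  rw [← Polynomial.map_dvd_map (ZInv d).subtype Subtype.val_injective
    (monic_prod_of_monic _ _ fun s _ => (cyclotomic.monic s _).pow b), Polynomial.map_prod]
  refine Finset.prod_dvd_of_coprime ?_ fun s hs => Polynomial.map_dvd _ (h s hs)
  intro s _ t _ hst
  simp only [Function.onFun, Polynomial.map_pow, map_cyclotomic]
  exact (cyclotomic.isCoprime_rat hst).pow

/-! ### Compatible sequences of polynomials. -/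

section Compatible

variable {d : ℕ} (hd : 0 < d) {F : ℕ → (ZInv d)[X]}
  (hF : ∀ m n, m ≤ n → cycloProd d m (ZInv d) ∣ F n - F m)
include hd hF

/-- F_n stabilizes modulo Φ_s^b from n = sb on, so vanishing there may be tested at any larger
index. -/
theorem cyclotomic_pow_dvd_sub {s b m n : ℕ} (hs : 0 < s) (hsd : s.Coprime d) (hm : s * b ≤ m)
    (hmn : m ≤ n) : cyclotomic s (ZInv d) ^ b ∣ F n - F m :=
  (cyclotomic_pow_dvd_cycloProd hd hs hsd _ b hm).trans (hF m n hmn)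

/-- A compatible sequence that vanishes at infinitely many roots of unity of prime power order
has vanishing Taylor expansion at `X = 1`. -/
theorem cyclotomic_one_pow_dvd {S : Set ℕ} (hS : S.Infinite) (hSpp : ∀ r ∈ S, IsPrimePow r)
    (hSd : ∀ r ∈ S, r.Coprime d) (hSF : ∀ r ∈ S, ∀ n, r ≤ n → cyclotomic r (ZInv d) ∣ F n)
    {N n : ℕ} (hn : N ≤ n) : cyclotomic 1 (ZInv d) ^ N ∣ F n := by
  refine dvd_of_mem_span_natCast_sup hd ((cyclotomic.monic _ _).pow N) fun C => ?_
  -- Orders below 2N are discarded because φ(p^k) ≥ p^k/2. Several orders may share a prime; it then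
  -- counts with multiplicity, so the product is at least 2^C.
  obtain ⟨T, hTS, hTC⟩ := (hS.sdiff (Set.finite_Iio (2 * N))).exists_subset_card_eq C
  have hpr : ∀ r ∈ T, r.minFac.Prime := fun r hr =>
    Nat.minFac_prime (hSpp r (hTS hr).1).ne_one
  refine ⟨∏ r ∈ T, r.minFac, ?_, ?_, ?_⟩
  · have h1 : 2 ^ C ≤ ∏ r ∈ T, r.minFac := by
      rw [← hTC, ← Finset.prod_const]
      exact Finset.prod_le_prod' fun r hr => (hpr r hr).two_le
    exact (Nat.lt_two_pow_self.le).trans h1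
  · exact Nat.Coprime.prod_left fun r hr =>
      (hSd r (hTS hr).1).coprime_dvd_left (Nat.minFac_dvd r)
  · set M := max n (T.sup id) with hM
    have h1 : ∏ r ∈ T, cyclotomic r (ZInv d) ∣ F M := by
      have := prod_cyclotomic_pow_dvd (F := F M) T 1 fun r hr => by
        rw [pow_one]
        exact hSF r (hTS hr).1 _ ((Finset.le_sup (f := id) hr).trans (le_max_right _ _))
      simpa using this
    have h2 : ∏ r ∈ T, cyclotomic r (ZInv d) ∈
        Ideal.span {∏ r ∈ T, ((r.minFac : ℕ) : (ZInv d)[X])} ⊔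
          Ideal.span {cyclotomic 1 (ZInv d) ^ N} := by
      refine prod_mem_span_prod_sup _ _ _ _ fun r hr => ?_
      obtain ⟨p, k, hp, hk, rfl⟩ := (isPrimePow_nat_iff r).1 (hSpp r (hTS hr).1)
      rw [hp.pow_minFac hk.ne']
      refine cyclotomic_prime_pow_mem hp hk ?_
      have h3 : 2 * N ≤ p ^ k := not_lt.1 (hTS hr).2
      obtain ⟨k, rfl⟩ := Nat.exists_eq_add_of_lt hk
      rw [zero_add] at h3 ⊢
      rw [Nat.totient_prime_pow_succ hp]
      have h4 : p ^ k * 2 ≤ p ^ k * p := Nat.mul_le_mul_left _ hp.two_le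
      rw [pow_succ] at h3
      rw [Nat.mul_sub_one]
      omega
    have h3 := Ideal.mem_of_dvd _ h1 h2
    have h4 : cyclotomic 1 (ZInv d) ^ N ∣ F M - F n :=
      cyclotomic_pow_dvd_sub hd hF one_pos (Nat.coprime_one_left d)
        (by rwa [one_mul]) (le_max_left n (T.sup id))
    rw [Nat.cast_prod]
    have h5 : F n = F M - (F M - F n) := by ring
    rw [h5]
    exact Ideal.sub_mem _ h3 (Ideal.mem_sup_right (Ideal.mem_span_singleton.2 h4))

/-- Vanishing of the expansion at `Φ_s` forces that of the expansion at `Φ_{ps}`. -/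
theorem cyclotomic_prime_mul_pow_dvd {p s : ℕ} (hp : p.Prime) (hs : 0 < s)
    (hsd : (p * s).Coprime d) (h : ∀ N, ∀ n, s * N ≤ n → cyclotomic s (ZInv d) ^ N ∣ F n)
    (b n : ℕ) (hn : p * s * b ≤ n) : cyclotomic (p * s) (ZInv d) ^ b ∣ F n := by
  refine dvd_of_mem_span_natCast_sup hd ((cyclotomic.monic _ _).pow b) fun C => ?_
  refine ⟨p ^ C, (Nat.lt_pow_self hp.one_lt).le,
    (hsd.coprime_dvd_left (dvd_mul_right p s)).pow_left C, ?_⟩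
  set M := max n (s * (p * (C + b)))
  have h1 := h (p * (C + b)) M (le_max_right _ _)
  -- By (I + J)^{C+b} ⊆ I^C + J^b with I = (p) and J = (Φ_{ps}).
  have h2 : cyclotomic s (ZInv d) ^ (p * (C + b)) ∈
      Ideal.span {((p ^ C : ℕ) : (ZInv d)[X])} ⊔
        Ideal.span {cyclotomic (p * s) (ZInv d) ^ b} := by
    rw [pow_mul, Nat.cast_pow, ← Ideal.span_singleton_pow, ← Ideal.span_singleton_pow]
    exact Ideal.sup_pow_add_le_pow_sup_pow
      (Ideal.pow_mem_pow (cyclotomic_pow_prime_mem s hp) _)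
  have h3 := Ideal.mem_of_dvd _ h1 h2
  have h4 := cyclotomic_pow_dvd_sub hd hF (Nat.mul_pos hp.pos hs) hsd hn
    (le_max_left n _ : n ≤ M)
  have h5 : F n = F M - (F M - F n) := by ring
  rw [h5]
  exact Ideal.sub_mem _ h3 (Ideal.mem_sup_right (Ideal.mem_span_singleton.2 h4))

theorem cyclotomic_pow_dvd_of_cyclotomic_one
    (h : ∀ N, ∀ n, N ≤ n → cyclotomic 1 (ZInv d) ^ N ∣ F n) (s : ℕ) :
    0 < s → s.Coprime d → ∀ b n, s * b ≤ n → cyclotomic s (ZInv d) ^ b ∣ F n := by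
  induction s using induction_on_primes with
  | zero => intro h0; exact absurd h0 (lt_irrefl 0)
  | one => intro _ _ b n hn; exact h b n (by rwa [one_mul] at hn)
  | prime_mul p s hp ih =>
    intro h0 hsd
    have hs := Nat.pos_of_mul_pos_left h0
    exact cyclotomic_prime_mul_pow_dvd hd hF hp hs hsd
      (ih hs (hsd.coprime_dvd_left (dvd_mul_left s p)))

theorem cycloProd_dvd_of_cyclotomic_dvd {S : Set ℕ} (hS : S.Infinite)
    (hSpp : ∀ r ∈ S, IsPrimePow r) (hSd : ∀ r ∈ S, r.Coprime d)
    (hSF : ∀ r ∈ S, ∀ n, r ≤ n → cyclotomic r (ZInv d) ∣ F n) (n : ℕ) :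
    cycloProd d n (ZInv d) ∣ F n := by
  have hall := cyclotomic_pow_dvd_of_cyclotomic_one hd hF fun N n hn =>
    cyclotomic_one_pow_dvd hd hF hS hSpp hSd hSF hn
  -- Every s that occurs is at most dn, and its exponent is at most n.
  set M := max n (d * n * n)
  have h1 : cycloProd d n (ZInv d) ∣ F M := by
    refine (cycloProd_dvd_prod_pow d n _).trans (prod_cyclotomic_pow_dvd _ _ fun s hs => ?_)
    rw [Finset.mem_filter, Finset.mem_Icc] at hs
    exact hall s hs.1.1 hs.2 n M
      ((Nat.mul_le_mul_right n hs.1.2).trans (le_max_right _ _))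
  exact (dvd_sub_right h1).1 (hF n M (le_max_left _ _)) |> fun h => by simpa using h

end Compatible

/-! ### Comaximality of cyclotomic polynomials. -/

/-- A root of `Φ_s` in a field is a primitive `m`-th root of unity, where `s / m` is a power of
the characteristic. -/
theorem exists_isPrimitiveRoot_of_cyclotomic_isRoot {K : Type*} [Field K] {s : ℕ} (hs : 0 < s)
    {ζ : K} (h : (cyclotomic s K).IsRoot ζ) :
    ∃ c m, s = c * m ∧ IsPrimitiveRoot ζ m ∧ ∀ d : ℕ, (d : K) ≠ 0 → c.Coprime d := by
  by_cases hs0 : (s : K) = 0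
  · have hc : ringChar K ≠ 0 := by
      intro h0
      have := (CharP.ringChar_zero_iff_CharZero K).1 h0
      exact hs.ne' (Nat.cast_eq_zero.1 hs0)
    have hp : (ringChar K).Prime := (CharP.char_is_prime_or_zero K _).resolve_right hc
    have : Fact (ringChar K).Prime := ⟨hp⟩
    obtain ⟨a, m, hm, rfl⟩ := Nat.exists_eq_pow_mul_and_not_dvd hs.ne' (ringChar K) hp.ne_one
    have : NeZero (m : K) := ⟨fun h => hm ((ringChar.spec K m).1 h)⟩
    exact ⟨_, m, rfl, isRoot_cyclotomic_prime_pow_mul_iff_of_charP.1 h, fun d hd =>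
      ((Nat.Prime.coprime_iff_not_dvd hp).2 fun h => hd ((ringChar.spec K d).2 h)).pow_left a⟩
  · have : NeZero (s : K) := ⟨hs0⟩
    exact ⟨1, s, by simp, isRoot_cyclotomic_iff.1 h, fun d _ => Nat.coprime_one_left d⟩

/-- The order m of a common root divides r, and s/m is coprime with d; so s would be coprime with d.
-/
theorem not_isRoot_cyclotomic {K : Type*} [Field K] {d r s : ℕ} (hd : (d : K) ≠ 0)
    (hr : r.Coprime d) (hs : 0 < s) (hsd : ¬ s.Coprime d) {ζ : K}
    (h1 : (cyclotomic r K).IsRoot ζ) : ¬ (cyclotomic s K).IsRoot ζ := by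
  intro h2
  obtain ⟨c, m, rfl, hm, hc⟩ := exists_isPrimitiveRoot_of_cyclotomic_isRoot hs h2
  have h3 : ζ ^ r = 1 := by
    have := h1.dvd (cyclotomic.dvd_X_pow_sub_one r K)
    simpa [sub_eq_zero] using this
  exact hsd (Nat.Coprime.mul_left (hc d hd) (hr.coprime_dvd_left (hm.dvd_of_pow_eq_one r h3)))

/-- A proper ideal (a, b) would vanish in the residue field of a maximal ideal. -/
theorem isCoprime_of_forall_ringHom_field.{u} {R : Type u} [CommRing R] {a b : R}
    (h : ∀ (K : Type u) [Field K] (f : R →+* K), f a = 0 → f b ≠ 0) : IsCoprime a b := by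
  rw [← Ideal.isCoprime_span_singleton_iff, Ideal.isCoprime_iff_sup_eq]
  by_contra hne
  obtain ⟨M, hM, hle⟩ := Ideal.exists_le_maximal _ hne
  let _ : Field (R ⧸ M) := Ideal.Quotient.field M
  exact h (R ⧸ M) (Ideal.Quotient.mk M)
    (Ideal.Quotient.eq_zero_iff_mem.2
      (hle (Ideal.mem_sup_left (Ideal.mem_span_singleton_self _))))
    (Ideal.Quotient.eq_zero_iff_mem.2
      (hle (Ideal.mem_sup_right (Ideal.mem_span_singleton_self _))))

/-- Over a ring in which `d` is invertible, `Φ_s` and `Φ_r` generate the unit ideal if `r` is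
coprime with `d` and `s` is not. -/
theorem isCoprime_cyclotomic {R : Type*} [CommRing R] {d r s : ℕ} (hd : IsUnit (d : R))
    (hr : r.Coprime d) (hs : 0 < s) (hsd : ¬ s.Coprime d) :
    IsCoprime (cyclotomic s R) (cyclotomic r R) := by
  refine isCoprime_of_forall_ringHom_field fun K _ f h1 h2 => ?_
  have hroot : ∀ n, f (cyclotomic n R) = 0 → (cyclotomic n K).IsRoot (f X) := by
    intro n hn
    rw [IsRoot.def, ← map_cyclotomic n (f.comp C), eval_map, ← Polynomial.hom_eval₂, eval₂_C_X, hn]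
  have hdK : (d : K) ≠ 0 := by
    have := hd.map (f.comp C)
    rw [map_natCast] at this
    exact this.ne_zero
  exact not_isRoot_cyclotomic hdK hr hs hsd (hroot r h2) (hroot s h1)

theorem isCoprime_X_cyclotomic {R : Type*} [CommRing R] {r : ℕ} (hr : 0 < r) :
    IsCoprime (X : R[X]) (cyclotomic r R) := by
  refine IsCoprime.of_isCoprime_of_dvd_right ?_ (cyclotomic.dvd_X_pow_sub_one r R)
  refine ⟨X ^ (r - 1), -1, ?_⟩
  rw [← pow_succ, Nat.sub_add_cancel hr]
  ring

/-! ### Comparison of ℤ[1/d][X] with `Λ_d` modulo (q;q)_n. -/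

noncomputable section

/-- The embedding of `ℤ[1/d][q^{1/d}]` into the field of rational functions. -/
def polyToRatFunc (d : ℕ) : (ZInv d)[X] →+* RatFunc ℚ :=
  (algebraMap ℚ[X] (RatFunc ℚ)).comp (mapRingHom (ZInv d).subtype)

theorem polyToRatFunc_apply (d : ℕ) (f : (ZInv d)[X]) :
    polyToRatFunc d f = algebraMap ℚ[X] (RatFunc ℚ) (f.map (ZInv d).subtype) := rfl

theorem polyToRatFunc_injective (d : ℕ) : Function.Injective (polyToRatFunc d) :=
  (RatFunc.algebraMap_injective ℚ).comp (ZInv.map_injective d)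

theorem polyToRatFunc_X (d : ℕ) : polyToRatFunc d X = qRoot := by
  rw [polyToRatFunc_apply, map_X, RatFunc.algebraMap_X, qRoot]

theorem polyToRatFunc_cyclotomic (d s : ℕ) : polyToRatFunc d (cyclotomic s (ZInv d)) =
    algebraMap ℚ[X] (RatFunc ℚ) (cyclotomic s ℚ) := by
  rw [polyToRatFunc_apply, map_cyclotomic]

theorem A_le_Lam (d : ℕ) : A d ≤ Lam d := fun _ hx => Subring.subset_closure (Or.inl hx)

theorem polyToRatFunc_mem_Lam (d : ℕ) (f : (ZInv d)[X]) : polyToRatFunc d f ∈ Lam d := by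
  induction f using Polynomial.induction_on' with
  | add f g hf hg => rw [map_add]; exact add_mem hf hg
  | monomial n a =>
    rw [← C_mul_X_pow_eq_monomial, map_mul, map_pow, polyToRatFunc_X]
    refine mul_mem ?_ (pow_mem (qRoot_mem_Lam d) n)
    obtain ⟨a, ha⟩ := a
    rw [polyToRatFunc_apply, map_C, RatFunc.algebraMap_C]
    refine A_le_Lam d ?_
    change RatFunc.C a ∈ A d
    have : ZInv d ≤ (A d).comap (RatFunc.C (K := ℚ)) := by
      refine Subring.closure_le.2 ?_
      rintro _ rfl
      refine Subring.subset_closure (Or.inl ?_)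
      simp
    exact this ha

/-- The embedding of `ℤ[1/d][q^{1/d}]` into `Λ_d`. -/
def polyToLam (d : ℕ) : (ZInv d)[X] →+* Lam d :=
  (polyToRatFunc d).codRestrict (Lam d) (polyToRatFunc_mem_Lam d)

section Denominators

variable {d : ℕ} {Q : (ZInv d)[X]} (hX : IsCoprime X Q)
  (hcyc : ∀ s, 0 < s → ¬ s.Coprime d → IsCoprime (cyclotomic s (ZInv d)) Q)
include hX hcyc

/-- Products of polynomials comaximal with Q are again comaximal with Q, so all denominators in
`Λ_d` are units modulo Q. -/
theorem exists_denominator {x : RatFunc ℚ} (hx : x ∈ Lam d) :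
    ∃ u y : (ZInv d)[X], IsCoprime u Q ∧ polyToRatFunc d u * x = polyToRatFunc d y := by
  have hzero : ∃ u y : (ZInv d)[X], IsCoprime u Q ∧
      polyToRatFunc d u * 0 = polyToRatFunc d y := ⟨1, 0, isCoprime_one_left, by simp⟩
  have hone : ∃ u y : (ZInv d)[X], IsCoprime u Q ∧
      polyToRatFunc d u * 1 = polyToRatFunc d y := ⟨1, 1, isCoprime_one_left, by simp⟩
  have hadd : ∀ x y : RatFunc ℚ,
      (∃ u z : (ZInv d)[X], IsCoprime u Q ∧ polyToRatFunc d u * x = polyToRatFunc d z) →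
      (∃ u z : (ZInv d)[X], IsCoprime u Q ∧ polyToRatFunc d u * y = polyToRatFunc d z) →
      ∃ u z : (ZInv d)[X], IsCoprime u Q ∧
        polyToRatFunc d u * (x + y) = polyToRatFunc d z := by
    rintro x y ⟨u, z, hu, hz⟩ ⟨v, w, hv, hw⟩
    refine ⟨u * v, v * z + u * w, hu.mul_left hv, ?_⟩
    simp only [map_mul, map_add, ← hz, ← hw]
    ring
  have hneg : ∀ x : RatFunc ℚ,
      (∃ u z : (ZInv d)[X], IsCoprime u Q ∧ polyToRatFunc d u * x = polyToRatFunc d z) →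
      ∃ u z : (ZInv d)[X], IsCoprime u Q ∧ polyToRatFunc d u * (-x) = polyToRatFunc d z := by
    rintro x ⟨u, z, hu, hz⟩
    exact ⟨u, -z, hu, by rw [map_neg, ← hz, mul_neg]⟩
  have hmul : ∀ x y : RatFunc ℚ,
      (∃ u z : (ZInv d)[X], IsCoprime u Q ∧ polyToRatFunc d u * x = polyToRatFunc d z) →
      (∃ u z : (ZInv d)[X], IsCoprime u Q ∧ polyToRatFunc d u * y = polyToRatFunc d z) →
      ∃ u z : (ZInv d)[X], IsCoprime u Q ∧
        polyToRatFunc d u * (x * y) = polyToRatFunc d z := by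
    rintro x y ⟨u, z, hu, hz⟩ ⟨v, w, hv, hw⟩
    refine ⟨u * v, z * w, hu.mul_left hv, ?_⟩
    simp only [map_mul, ← hz, ← hw]
    ring
  have hinv : ∀ u : (ZInv d)[X], IsCoprime u Q → u ≠ 0 → ∃ v z : (ZInv d)[X], IsCoprime v Q ∧
      polyToRatFunc d v * (polyToRatFunc d u)⁻¹ = polyToRatFunc d z := by
    intro u hu hu0
    refine ⟨u, 1, hu, ?_⟩
    rw [map_one, mul_inv_cancel₀]
    exact (map_ne_zero_iff _ (polyToRatFunc_injective d)).2 hu0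
  refine Subring.closure_induction ?_ hzero hone (fun x y _ _ => hadd x y)
    (fun x _ => hneg x) (fun x y _ _ => hmul x y) hx
  rintro x (hx | ⟨s, hs, hsd, rfl⟩)
  · refine Subring.closure_induction ?_ hzero hone (fun x y _ _ => hadd x y)
      (fun x _ => hneg x) (fun x y _ _ => hmul x y) hx
    rintro x (rfl | rfl | rfl)
    · refine ⟨1, C ⟨(d : ℚ)⁻¹, Subring.subset_closure rfl⟩, isCoprime_one_left, ?_⟩
      rw [polyToRatFunc_apply, polyToRatFunc_apply, map_C, RatFunc.algebraMap_C]
      simp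
    · exact ⟨1, X, isCoprime_one_left, by rw [map_one, one_mul, polyToRatFunc_X]⟩
    · rw [← polyToRatFunc_X d]
      exact hinv X hX X_ne_zero
  · rw [← polyToRatFunc_cyclotomic d]
    exact hinv _ (hcyc s hs hsd) (cyclotomic_ne_zero s _)

/-- `ℤ[1/d][q^{1/d}] → Λ_d / (Q)` is surjective. -/
theorem exists_sub_polyToLam_mem (x : Lam d) :
    ∃ F : (ZInv d)[X], x - polyToLam d F ∈ Ideal.span {polyToLam d Q} := by
  obtain ⟨u, y, ⟨a, b, hab⟩, h⟩ := exists_denominator hX hcyc x.2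
  have h1 : polyToLam d u * x = polyToLam d y := Subtype.ext h
  -- From au + bQ = 1, a inverts the denominator u modulo Q, and x - ay = bQx.
  refine ⟨a * y, Ideal.mem_span_singleton.2 ⟨polyToLam d b * x, ?_⟩⟩
  have h2 := congrArg (polyToLam d) hab
  rw [map_add, map_mul, map_mul, map_one] at h2
  rw [map_mul, ← h1]
  linear_combination -x * h2

/-- `ℤ[1/d][q^{1/d}] / (Q) → Λ_d / (Q)` is injective. -/
theorem dvd_of_polyToLam_mem {F : (ZInv d)[X]}
    (h : polyToLam d F ∈ Ideal.span {polyToLam d Q}) : Q ∣ F := by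
  obtain ⟨x, hx⟩ := Ideal.mem_span_singleton.1 h
  obtain ⟨u, y, hu, h1⟩ := exists_denominator hX hcyc x.2
  have h2 : u * F = Q * y := by
    apply polyToRatFunc_injective d
    have h3 : polyToRatFunc d F = polyToRatFunc d Q * x := congrArg Subtype.val hx
    rw [map_mul, map_mul, h3, ← h1]
    ring
  exact hu.symm.dvd_of_dvd_mul_left ⟨y, h2⟩

end Denominators

theorem isCoprime_X_cycloProd {d : ℕ} (n : ℕ) (R : Type*) [CommRing R] :
    IsCoprime X (cycloProd d n R) :=
  IsCoprime.prod_right fun _ _ => IsCoprime.prod_right fun _ hs =>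
    isCoprime_X_cyclotomic (Nat.pos_of_mem_divisors (Finset.mem_filter.1 hs).1)

theorem isCoprime_cyclotomic_cycloProd {d : ℕ} (hd : 0 < d) (n : ℕ) {s : ℕ} (hs : 0 < s)
    (hsd : ¬ s.Coprime d) :
    IsCoprime (cyclotomic s (ZInv d)) (cycloProd d n (ZInv d)) :=
  IsCoprime.prod_right fun _ _ => IsCoprime.prod_right fun _ hr =>
    isCoprime_cyclotomic (ZInv.isUnit_natCast hd) (Finset.mem_filter.1 hr).2 hs hsd

theorem isUnit_polyToLam_cyclotomic {d s : ℕ} (hs : 0 < s) (hsd : ¬ s.Coprime d) :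
    IsUnit (polyToLam d (cyclotomic s (ZInv d))) := by
  refine IsUnit.of_mul_eq_one ⟨(algebraMap ℚ[X] (RatFunc ℚ) (cyclotomic s ℚ))⁻¹,
    Subring.subset_closure (Or.inr ⟨s, hs, hsd, rfl⟩)⟩ ?_
  apply Subtype.ext
  change polyToRatFunc d _ * _ = 1
  rw [polyToRatFunc_cyclotomic]
  exact mul_inv_cancel₀ ((map_ne_zero_iff _ (RatFunc.algebraMap_injective ℚ)).2
    (cyclotomic_ne_zero s ℚ))

theorem polyToLam_X_pow (d : ℕ) : polyToLam d (X ^ d) = q d := by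
  rw [map_pow, q]
  congr 1
  exact Subtype.ext (polyToRatFunc_X d)

/-- Up to a unit of `Λ_d`, `(q;q)_n` is the product of the `Φ_s(q^{1/d})` that divide it with
`s` coprime with `d`. -/
theorem associated_qPochhammer {d : ℕ} (hd : 0 < d) (n : ℕ) :
    Associated (polyToLam d (cycloProd d n (ZInv d))) (qPochhammer (q d) (q d) n) := by
  rw [cycloProd, qPochhammer, map_prod]
  refine Associated.prod _ _ _ fun i _ => ?_
  have h1 : 1 - q d * q d ^ i = - polyToLam d (X ^ (d * (i + 1)) - 1) := by
    rw [map_sub, map_one, pow_mul, map_pow, polyToLam_X_pow]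
    ring
  rw [h1, ← prod_cyclotomic_eq_X_pow_sub_one (Nat.mul_pos hd (Nat.add_pos_right i one_pos)),
    ← Finset.prod_filter_mul_prod_filter_not (d * (i + 1)).divisors (fun s => s.Coprime d), map_mul]
  have h2 : IsUnit (polyToLam d
      (∏ s ∈ (d * (i + 1)).divisors with ¬ s.Coprime d, cyclotomic s (ZInv d))) := by
    rw [map_prod]
    refine Finset.prod_induction _ IsUnit (fun _ _ => IsUnit.mul) isUnit_one fun s hs => ?_
    exact isUnit_polyToLam_cyclotomic (Nat.pos_of_mem_divisors (Finset.mem_filter.1 hs).1)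
      (Finset.mem_filter.1 hs).2
  exact (associated_mul_unit_right _ _ h2).neg_right

theorem qIdeal_eq_span {d : ℕ} (hd : 0 < d) (n : ℕ) :
    qIdeal d n = Ideal.span {polyToLam d (cycloProd d n (ZInv d))} :=
  (Ideal.span_singleton_eq_span_singleton.2 (associated_qPochhammer hd n)).symm

theorem exists_polynomial_representatives {d : ℕ} (hd : 0 < d) (f : LamHat d) :
    ∃ F : ℕ → (ZInv d)[X], ∀ n, Ideal.Quotient.mk (qIdeal d n) (polyToLam d (F n)) =
      (f : (n : ℕ) → Lam d ⧸ qIdeal d n) n := by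
  have : ∀ n, ∃ F, Ideal.Quotient.mk (qIdeal d n) (polyToLam d F) =
      (f : (n : ℕ) → Lam d ⧸ qIdeal d n) n := by
    intro n
    obtain ⟨x, hx⟩ := Ideal.Quotient.mk_surjective ((f : (n : ℕ) → Lam d ⧸ qIdeal d n) n)
    obtain ⟨F, hF⟩ := exists_sub_polyToLam_mem (isCoprime_X_cycloProd n (ZInv d))
      (fun s => isCoprime_cyclotomic_cycloProd hd n) x
    rw [← qIdeal_eq_span hd] at hF
    exact ⟨F, ((Ideal.Quotient.eq.2 hF).symm).trans hx⟩
  choose F hF using this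
  exact ⟨F, hF⟩

theorem cycloProd_dvd_of_mk_eq_zero {d : ℕ} (hd : 0 < d) {n : ℕ} {F : (ZInv d)[X]}
    (h : Ideal.Quotient.mk (qIdeal d n) (polyToLam d F) = 0) : cycloProd d n (ZInv d) ∣ F := by
  rw [Ideal.Quotient.eq_zero_iff_mem, qIdeal_eq_span hd] at h
  exact dvd_of_polyToLam_mem (isCoprime_X_cycloProd n (ZInv d))
    (fun s => isCoprime_cyclotomic_cycloProd hd n) h

/-! ### Evaluations at roots of unity. -/

theorem isPrimitiveRoot_rootValue (d : ℕ) {ξ : ℂ} (hξ : ξ ∈ U d) :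
    IsPrimitiveRoot (rootValue d hξ) (orderOf ξ) := by
  refine ⟨rootValue_pow_orderOf d hξ, fun l hl => orderOf_dvd_of_pow_eq_one ?_⟩
  rw [← rootValue_pow d hξ, ← pow_mul, mul_comm, pow_mul, hl, one_pow]

/-- Φ_r is the minimal polynomial over ℚ of the value of X, and being monic it still divides over
ℤ[1/d]. -/
theorem cyclotomic_dvd_of_evLam_eq_zero {d : ℕ} {ξ : ℂ} (hξ : ξ ∈ U d) {F : (ZInv d)[X]}
    (h : evLam d hξ (polyToLam d F) = 0) : cyclotomic (orderOf ξ) (ZInv d) ∣ F := by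
  rw [← Polynomial.map_dvd_map (ZInv d).subtype Subtype.val_injective (cyclotomic.monic _ _),
    map_cyclotomic, cyclotomic_eq_minpoly_rat (isPrimitiveRoot_rootValue d hξ) hξ.1.pos]
  refine minpoly.dvd _ _ ?_
  change RatFunc.eval _ _ (algebraMap ℚ[X] (RatFunc ℚ) (F.map (ZInv d).subtype)) = 0 at h
  rwa [RatFunc.eval_algebraMap] at h

/-- Each order is shared by finitely many roots of unity. -/
theorem infinite_image_orderOf {s : Set ℂ} (hs : s.Infinite) (h0 : ∀ ξ ∈ s, 0 < orderOf ξ) :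
    (orderOf '' s).Infinite := by
  intro hfin
  refine hs ((hfin.biUnion fun r _ => (Polynomial.nthRootsFinset r (1 : ℂ)).finite_toSet).subset
    fun ξ hξ => Set.mem_biUnion (Set.mem_image_of_mem _ hξ) ?_)
  exact (Polynomial.mem_nthRootsFinset (h0 ξ hξ) 1).2 (pow_orderOf_eq_one ξ)

end

end CycloCompletion

theorem mainTheorem3 (d : ℕ) (hd : 0 < d) (Ω : Set ℂ) (hΩ : Ω ⊆ CycloCompletion.U d)
    (hinf : {ξ ∈ Ω | IsPrimePow (orderOf ξ)}.Infinite) :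
    Function.Injective (CycloCompletion.evOn d hΩ) := by
  open CycloCompletion Polynomial in
  rw [injective_iff_map_eq_zero]
  intro f hf
  obtain ⟨F, hF⟩ := exists_polynomial_representatives hd f
  have hcompat : ∀ m n, m ≤ n → cycloProd d m (ZInv d) ∣ F n - F m := by
    intro m n hmn
    refine cycloProd_dvd_of_mk_eq_zero hd ?_
    rw [map_sub, map_sub, hF m, ← f.2 m n hmn, ← hF n, Ideal.Quotient.factor_mk, sub_self]
  have hvan : ∀ r ∈ orderOf '' {ξ ∈ Ω | IsPrimePow (orderOf ξ)}, ∀ n, r ≤ n →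
      cyclotomic r (ZInv d) ∣ F n := by
    rintro _ ⟨ξ, hξ, rfl⟩ n hn
    refine cyclotomic_dvd_of_evLam_eq_zero (hΩ hξ.1) ?_
    have h1 : ev d (hΩ hξ.1) f = 0 := congrFun hf ⟨ξ, hξ.1⟩
    rwa [ev_eq d (hΩ hξ.1) hn, ← hF n, Ideal.Quotient.lift_mk] at h1
  have hdvd := cycloProd_dvd_of_cyclotomic_dvd hd hcompat
    (infinite_image_orderOf hinf fun ξ hξ => (hΩ hξ.1).1.pos)
    (by rintro _ ⟨ξ, hξ, rfl⟩; exact hξ.2)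
    (by rintro _ ⟨ξ, hξ, rfl⟩; exact (hΩ hξ.1).2) hvan
  apply Subtype.ext
  funext n
  rw [← hF n]
  change _ = 0
  rw [Ideal.Quotient.eq_zero_iff_mem, qIdeal_eq_span hd, Ideal.mem_span_singleton]
  exact map_dvd _ (hdvd n)
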